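/- Let $a,a^\dagger$ be the annihilation and creation operators of a bosonic mode with Fock basis $(|n\rangle)_{n\ge 0}$. For $\beta\in\mathbb C$ and $p\in\mathbb N$ let $|p,\beta\rangle=D(\beta)|p\rangle$ be the displaced Fock state, where $D(\beta)=\exp(\beta a^\dagger-\beta^* a)$ is defined on Fock states by its exponential series. Let $\Theta=e^{-\hbar\omega/(k_BT)}\in[0,1)$ (with $\Theta=0$ for zero temperature) and $Z=\sum_{p\ge0}\Theta^p$, and consider the symmetric two-mode displaced thermal state $$\hat\rho=\sum_{p,m\ge 0}\frac{\Theta^{p+m}}{Z^2}\,|p,\beta\rangle|m,\beta\rangle\langle p,\beta|\langle m,\beta| ,$$ that is, both modes have the same displacement $\beta_1=\beta_2=\beta$ and the same Boltzmann factor $\Theta_1=\Theta_2=\Theta$. Exclude only the vacuum ($\beta=0$ and $\Theta=0$), which has no two-photon component. Let $\hat\rho^{(2)}$ be the compression of $\hat\rho$ to the span of $|20\rangle,|11\rangle,|02\rangle$, transported to $\mathbb C^2\otimes\mathbb C^2$ (two particles $a,b$, each in one of the two modes $\psi_1,\psi_2$) by the isometry $$|20\rangle\mapsto|\psi_1^a\psi_1^b\rangle,\qquad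 |11\rangle\mapsto\tfrac1{\sqrt2}\big(|\psi_1^a\psi_2^b\rangle+|\psi_2^a\psi_1^b\rangle\big),\qquad |02\rangle\mapsto|\psi_2^a\psi_2^b\rangle ,$$ and normalised to unit trace. Then all the series above converge (those for $D(\beta)|p\rangle$ and for $\hat\rho$ componentwise in the Fock basis), $\hat\rho^{(2)}$ is a density matrix, and its partial transpose with respect to one particle is positive semidefinite, and even positive definite when $\Theta>0$. Moreover $\hat\rho^{(2)}$ is not formally entangled: it is separable, i.e. a finite convex combination $\sum_i w_i\,\sigma_i\otimes\tau_i$ of products of single-particle density matrices. -/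

import Mathlib

open scoped ComplexOrder Kronecker

noncomputable section

namespace DisplacedThermal

/-! ### One bosonic mode

A (possibly unnormalised) vector of one mode is given by its amplitudes `ψ n = ⟨n|ψ⟩` in the
Fock basis `|0⟩, |1⟩, |2⟩, …`. -/

/-- The creation operator `a†`, with `a†|n⟩ = √(n+1) |n+1⟩`. -/
def creation : (ℕ → ℂ) →ₗ[ℂ] (ℕ → ℂ) where
  toFun ψ n := (Real.sqrt n : ℂ) * ψ (n - 1)
  map_add' ψ φ := by
    funext n
    simp [mul_add]
  map_smul' c ψ := by
    funext n
    simp [mul_left_comm]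

/-- The annihilation operator `a`, with `a|n⟩ = √n |n-1⟩` (and `a|0⟩ = 0`). -/
def annihilation : (ℕ → ℂ) →ₗ[ℂ] (ℕ → ℂ) where
  toFun ψ n := (Real.sqrt (n + 1) : ℂ) * ψ (n + 1)
  map_add' ψ φ := by
    funext n
    simp [mul_add]
  map_smul' c ψ := by
    funext n
    simp [mul_left_comm]

/-- The Fock state `|p⟩`. -/
def fock (p : ℕ) : ℕ → ℂ := Pi.single p 1

/-- The generator `β a† - β* a` of the displacement operator `D(β) = exp(β a† - β* a)`. -/
def displacementGenerator (β : ℂ) : Module.End ℂ (ℕ → ℂ) :=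
  β • creation - (starRingEnd ℂ β) • annihilation

/-- The `k`-th term of the exponential series of `D(β)|p⟩`, in the component along `|n⟩`:
`⟨n| (β a† - β* a)^k |p⟩ / k!`. -/
def displacementTerm (β : ℂ) (p n k : ℕ) : ℂ :=
  ((displacementGenerator β ^ k) (fock p)) n / (k.factorial : ℂ)

/-- The displaced Fock state `|p, β⟩ = D(β)|p⟩ = ∑ₖ (β a† - β* a)^k |p⟩ / k!`. -/
def displacedFock (β : ℂ) (p : ℕ) : ℕ → ℂ :=
  fun n => ∑' k : ℕ, displacementTerm β p n k

/-- The partition function `Z = ∑ₚ Θ^p` of a mode with Boltzmann factor `Θ`. -/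
def partitionFunction (Θ : ℝ) : ℝ := ∑' p : ℕ, Θ ^ p

/-! ### Two modes

The Fock basis `|n₁ n₂⟩` is indexed by `n = (n₁, n₂) : ℕ × ℕ`. -/

/-- The two-mode displaced Fock state `|p₁, β₁⟩|p₂, β₂⟩`. -/
def displacedFock₂ (β₁ β₂ : ℂ) (p n : ℕ × ℕ) : ℂ :=
  displacedFock β₁ p.1 n.1 * displacedFock β₂ p.2 n.2

/-- The contribution of `p = (p₁, p₂)` to the matrix element `⟨n|ρ|m⟩` of the displaced thermal
state: `Θ₁^p₁ Θ₂^p₂ / (Z₁ Z₂) ⟨n|(|p₁, β₁⟩|p₂, β₂⟩)(⟨p₁, β₁|⟨p₂, β₂|)|m⟩`. -/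
def thermalTerm (β₁ β₂ : ℂ) (Θ₁ Θ₂ : ℝ) (n m p : ℕ × ℕ) : ℂ :=
  ((Θ₁ ^ p.1 * Θ₂ ^ p.2 / (partitionFunction Θ₁ * partitionFunction Θ₂) : ℝ) : ℂ) *
    (displacedFock₂ β₁ β₂ p n * starRingEnd ℂ (displacedFock₂ β₁ β₂ p m))

/-- The two-mode displaced thermal state with displacements `β₁, β₂` and Boltzmann factors
`Θᵢ = exp(-ħωᵢ/(k_B Tᵢ))`, as its matrix `⟨n|ρ|m⟩` in the Fock basis. -/
def displacedThermal (β₁ β₂ : ℂ) (Θ₁ Θ₂ : ℝ) : Matrix (ℕ × ℕ) (ℕ × ℕ) ℂ :=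
  fun n m => ∑' p : ℕ × ℕ, thermalTerm β₁ β₂ Θ₁ Θ₂ n m p

/-! ### The two-photon subspace -/

/-- The Fock states with two photons in total: `|02⟩, |11⟩, |20⟩`. -/
abbrev TwoPhoton : Type := {n : ℕ × ℕ // n ∈ Finset.HasAntidiagonal.antidiagonal 2}

/-- The compression of a two-mode operator to the two-photon subspace. -/
def restrictTwoPhoton (ρ : Matrix (ℕ × ℕ) (ℕ × ℕ) ℂ) : Matrix TwoPhoton TwoPhoton ℂ :=
  ρ.submatrix Subtype.val Subtype.val

/-- The occupation numbers of the two modes when the particles `a`, `b` are in the modes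
`x.1`, `x.2` (the mode `0 : Fin 2` is the first one). -/
def occupation (x : Fin 2 × Fin 2) : ℕ × ℕ :=
  ((if x.1 = 0 then 1 else 0) + (if x.2 = 0 then 1 else 0),
    (if x.1 = 1 then 1 else 0) + (if x.2 = 1 then 1 else 0))

/-- The isometry from the two-photon subspace into the space `ℂ² ⊗ ℂ²` of two particles:
`|20⟩ ↦ |ψ₁ᵃψ₁ᵇ⟩`, `|11⟩ ↦ (|ψ₁ᵃψ₂ᵇ⟩ + |ψ₂ᵃψ₁ᵇ⟩)/√2`, `|02⟩ ↦ |ψ₂ᵃψ₂ᵇ⟩`. -/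
def firstQuantisation : Matrix (Fin 2 × Fin 2) TwoPhoton ℂ :=
  fun x n => if occupation x = n.1 then (if n.1 = (1, 1) then (1 / Real.sqrt 2 : ℝ) else 1) else 0

/-- The restriction of a two-mode operator to the two-photon subspace, written in the
two-particle basis `|ψᵢᵃψⱼᵇ⟩`. -/
def twoParticleMatrix (ρ : Matrix (ℕ × ℕ) (ℕ × ℕ) ℂ) :
    Matrix (Fin 2 × Fin 2) (Fin 2 × Fin 2) ℂ :=
  firstQuantisation * restrictTwoPhoton ρ * firstQuantisation.conjTranspose

/-- The two-photon component of a two-mode state, as a normalised state of two particles. -/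
def twoPhotonState (ρ : Matrix (ℕ × ℕ) (ℕ × ℕ) ℂ) : Matrix (Fin 2 × Fin 2) (Fin 2 × Fin 2) ℂ :=
  (twoParticleMatrix ρ).trace⁻¹ • twoParticleMatrix ρ

/-! ### Separability -/

/-- The partial transpose with respect to the second particle. -/
def partialTranspose (ρ : Matrix (Fin 2 × Fin 2) (Fin 2 × Fin 2) ℂ) :
    Matrix (Fin 2 × Fin 2) (Fin 2 × Fin 2) ℂ :=
  fun x y => ρ (x.1, y.2) (y.1, x.2)

/-- Density matrices: positive semidefinite with unit trace. -/
def IsDensityMatrix {ι : Type*} [Fintype ι] (ρ : Matrix ι ι ℂ) : Prop :=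
  ρ.PosSemidef ∧ ρ.trace = 1

/-- A two-particle state is separable if it is a convex combination of product states. -/
def IsSeparable (ρ : Matrix (Fin 2 × Fin 2) (Fin 2 × Fin 2) ℂ) : Prop :=
  ∃ (N : ℕ) (w : Fin N → ℝ) (σ τ : Fin N → Matrix (Fin 2) (Fin 2) ℂ),
    (∀ i, 0 ≤ w i) ∧ ∑ i, w i = 1 ∧
    (∀ i, IsDensityMatrix (σ i)) ∧ (∀ i, IsDensityMatrix (τ i)) ∧
    ρ = ∑ i, (w i : ℂ) • (σ i ⊗ₖ τ i)

/-- A state of two particles is formally entangled if it is not separable with respect to the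
partition into the individual particles. -/
def IsFormallyEntangled (ρ : Matrix (Fin 2 × Fin 2) (Fin 2 × Fin 2) ℂ) : Prop :=
  ¬ IsSeparable ρ

end DisplacedThermal

end

namespace DisplacedThermal

/-! A displaced thermal state is a Gaussian mixture of coherent states, and the two-photon part of a
product of coherent states with amplitudes `α`, `α'` is proportional to `v ⊗ v` with `v = (α, α')`.
A positive mixture of such vectors is separable. The factor `exp(-|α|²)` in the coherent matrix
elements can be absorbed in the Gaussian, which then has mean `(1 - Θ) β` and variance `Θ`.

No integral is needed. The canonical commutation relation yields `a D(β) = D(β) (a + β)` and its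
counterpart for `a†`; together they give a recurrence for the thermal matrix elements
(`sqrt_mul_modeMatrix_succ`). After rescaling by `√(n! m!)` this is the moment recurrence of the
Gaussian. Two photons involve only exponents up to 2, so a five-point ensemble with the same moments
replaces the Gaussian (`scaledModeMatrix_eq_moment`), and two modes give a mixture of 25 product
operators (`exists_twoParticleMatrix_eq`).

Separability implies positivity of the partial transpose. For `Θ > 0` positivity is strict because
the vectors `v ⊗ v*` of the ensemble span the whole space (`eq_zero_of_ensembleVector`). -/

lemma creation_apply (ψ : ℕ → ℂ) (n : ℕ) :
    creation ψ n = (Real.sqrt n : ℂ) * ψ (n - 1) := rfl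

lemma annihilation_apply (ψ : ℕ → ℂ) (n : ℕ) :
    annihilation ψ n = (Real.sqrt (n + 1) : ℂ) * ψ (n + 1) := rfl

lemma displacementGenerator_apply (β : ℂ) (ψ : ℕ → ℂ) (n : ℕ) :
    displacementGenerator β ψ n =
      β * ((Real.sqrt n : ℂ) * ψ (n - 1)) -
        starRingEnd ℂ β * ((Real.sqrt (n + 1) : ℂ) * ψ (n + 1)) := rfl

lemma ofReal_sqrt_mul_self {x : ℝ} (hx : 0 ≤ x) :
    (Real.sqrt x : ℂ) * (Real.sqrt x : ℂ) = x := by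
  rw [← Complex.ofReal_mul, Real.mul_self_sqrt hx]

lemma ofReal_sqrt_ne_zero {x : ℝ} (hx : 0 < x) : (Real.sqrt x : ℂ) ≠ 0 :=
  Complex.ofReal_ne_zero.2 (Real.sqrt_pos.2 hx).ne'

/-! ### Commutation relations and the terms of the exponential series -/

/-- The canonical commutation relation. -/
lemma annihilation_mul_creation :
    annihilation * creation = creation * annihilation + (1 : Module.End ℂ (ℕ → ℂ)) := by
  ext ψ n
  have h (m : ℕ) : (Real.sqrt ((m : ℝ) + 1) : ℂ) * (Real.sqrt ((m : ℝ) + 1) : ℂ) = m + 1 := by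
    rw [ofReal_sqrt_mul_self (by positivity)]
    push_cast
    rfl
  simp only [Module.End.mul_apply, LinearMap.add_apply, Pi.add_apply, Module.End.one_apply,
    creation_apply, annihilation_apply]
  cases n with
  | zero => simp
  | succ n =>
    have h1 := h (n + 1)
    have h2 := h n
    push_cast at h1 h2 ⊢
    rw [← mul_assoc, ← mul_assoc, h1, h2]
    ring

lemma annihilation_mul_generator (β : ℂ) :
    annihilation * displacementGenerator β =
      displacementGenerator β * annihilation + β • (1 : Module.End ℂ (ℕ → ℂ)) := by
  rw [displacementGenerator, mul_sub, sub_mul, mul_smul_comm, mul_smul_comm, smul_mul_assoc,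
    smul_mul_assoc, annihilation_mul_creation, smul_add]
  abel

lemma creation_mul_generator (β : ℂ) :
    creation * displacementGenerator β =
      displacementGenerator β * creation + starRingEnd ℂ β • (1 : Module.End ℂ (ℕ → ℂ)) := by
  rw [displacementGenerator, mul_sub, sub_mul, mul_smul_comm, mul_smul_comm, smul_mul_assoc,
    smul_mul_assoc, annihilation_mul_creation, smul_add]
  abel

/-- If `[X, A] = c` is a scalar then `[X, A ^ (k + 1)] = (k + 1) c A ^ k`. -/
lemma mul_pow_succ_of_commutator {X A : Module.End ℂ (ℕ → ℂ)} {c : ℂ}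
    (h : X * A = A * X + c • 1) (k : ℕ) :
    X * A ^ (k + 1) = A ^ (k + 1) * X + ((k + 1 : ℕ) * c) • A ^ k := by
  induction k with
  | zero => simp [h]
  | succ k ih =>
    rw [pow_succ, ← mul_assoc, ih, add_mul, mul_assoc, h, mul_add, ← mul_assoc,
      mul_smul_comm, mul_one, smul_mul_assoc, add_assoc, mul_assoc, ← pow_succ,
      ← add_smul]
    congr 2
    push_cast
    ring

lemma annihilation_fock (p : ℕ) :
    annihilation (fock p) = (Real.sqrt p : ℂ) • fock (p - 1) := by
  ext n
  simp only [annihilation_apply, fock, Pi.single_apply, Pi.smul_apply, smul_eq_mul]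
  rcases p with _ | p
  · simp
  · by_cases h : n = p
    · simp [h]
    · simp [h]

lemma creation_fock (p : ℕ) :
    creation (fock p) = (Real.sqrt (p + 1) : ℂ) • fock (p + 1) := by
  ext n
  simp only [creation_apply, fock, Pi.single_apply, Pi.smul_apply, smul_eq_mul]
  rcases n with _ | n
  · simp
  · by_cases h : n = p
    · simp [h]
    · simp [h]

lemma displacementTerm_zero (β : ℂ) (p n : ℕ) :
    displacementTerm β p n 0 = fock p n := by
  simp [displacementTerm]

lemma annihilation_displacementTerm_zero (β : ℂ) (p n : ℕ) :
    (Real.sqrt (n + 1) : ℂ) * displacementTerm β p (n + 1) 0 =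
      (Real.sqrt p : ℂ) * displacementTerm β (p - 1) n 0 := by
  simpa [displacementTerm_zero, annihilation_apply] using congrFun (annihilation_fock p) n

lemma creation_displacementTerm_zero (β : ℂ) (p n : ℕ) :
    (Real.sqrt n : ℂ) * displacementTerm β p (n - 1) 0 =
      (Real.sqrt (p + 1) : ℂ) * displacementTerm β (p + 1) n 0 := by
  simpa [displacementTerm_zero, creation_apply] using congrFun (creation_fock p) n

lemma annihilation_displacementTerm_succ (β : ℂ) (p n k : ℕ) :
    (Real.sqrt (n + 1) : ℂ) * displacementTerm β p (n + 1) (k + 1) =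
      (Real.sqrt p : ℂ) * displacementTerm β (p - 1) n (k + 1) +
        β * displacementTerm β p n k := by
  have h := congrFun (LinearMap.congr_fun
    (mul_pow_succ_of_commutator (annihilation_mul_generator β) k) (fock p)) n
  simp only [Module.End.mul_apply, LinearMap.add_apply, Pi.add_apply, LinearMap.smul_apply,
    Pi.smul_apply, smul_eq_mul, annihilation_fock, map_smul] at h
  rw [annihilation_apply] at h
  have hk : (k.factorial : ℂ) ≠ 0 := Nat.cast_ne_zero.2 k.factorial_ne_zero
  have hk' : ((k : ℂ) + 1) ≠ 0 := Nat.cast_add_one_ne_zero k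
  simp only [displacementTerm, Nat.factorial_succ]
  push_cast at h ⊢
  field_simp
  linear_combination h

lemma creation_displacementTerm_succ (β : ℂ) (p n k : ℕ) :
    (Real.sqrt n : ℂ) * displacementTerm β p (n - 1) (k + 1) =
      (Real.sqrt (p + 1) : ℂ) * displacementTerm β (p + 1) n (k + 1) +
        starRingEnd ℂ β * displacementTerm β p n k := by
  have h := congrFun (LinearMap.congr_fun
    (mul_pow_succ_of_commutator (creation_mul_generator β) k) (fock p)) n
  simp only [Module.End.mul_apply, LinearMap.add_apply, Pi.add_apply, LinearMap.smul_apply,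
    Pi.smul_apply, smul_eq_mul, creation_fock, map_smul] at h
  rw [creation_apply] at h
  have hk : (k.factorial : ℂ) ≠ 0 := Nat.cast_ne_zero.2 k.factorial_ne_zero
  have hk' : ((k : ℂ) + 1) ≠ 0 := Nat.cast_add_one_ne_zero k
  simp only [displacementTerm, Nat.factorial_succ]
  push_cast at h ⊢
  field_simp
  linear_combination h

/-! ### Convergence of the exponential series -/

/-- `A ^ k |p⟩` has no component above `|p + k⟩`. -/
lemma generator_pow_fock_eq_zero (β : ℂ) (p k n : ℕ) (h : p + k < n) :
    (displacementGenerator β ^ k) (fock p) n = 0 := by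
  induction k generalizing n with
  | zero =>
    have : n ≠ p := by omega
    simp [fock, this]
  | succ k ih =>
    rw [pow_succ', Module.End.mul_apply, displacementGenerator_apply, ih _ (by omega),
      ih _ (by omega)]
    simp

/-- On components up to `p + k`, each of the two ladder terms of the generator costs at most a
factor `‖β‖ √(p + k + 1)`. -/
lemma norm_generator_pow_fock_le (β : ℂ) (p k n : ℕ) :
    ‖(displacementGenerator β ^ k) (fock p) n‖ ≤
      (2 * ‖β‖) ^ k * Real.sqrt ((p + k).factorial) := by
  induction k generalizing n with
  | zero =>
    have h1 : (1 : ℝ) ≤ Real.sqrt (p.factorial) :=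
      Real.one_le_sqrt.2 (by exact_mod_cast p.factorial_pos)
    by_cases h : n = p
    · simpa [fock, h] using h1
    · simp [fock, h]
  | succ k ih =>
    rcases lt_or_ge (p + (k + 1)) n with h | h
    · rw [generator_pow_fock_eq_zero β p _ n h, norm_zero]
      positivity
    have key (x : ℝ) (m : ℕ) (hx : x ≤ (p + k + 1 : ℕ) ∨
        (displacementGenerator β ^ k) (fock p) m = 0) :
        ‖(Real.sqrt x : ℂ) * (displacementGenerator β ^ k) (fock p) m‖ ≤
          Real.sqrt ((p + k + 1 : ℕ)) * ((2 * ‖β‖) ^ k * Real.sqrt ((p + k).factorial)) := by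
      rcases hx with hx | hx
      · rw [norm_mul, Complex.norm_real, Real.norm_of_nonneg (Real.sqrt_nonneg _)]
        exact mul_le_mul (Real.sqrt_le_sqrt hx) (ih m) (norm_nonneg _) (Real.sqrt_nonneg _)
      · rw [hx, mul_zero, norm_zero]
        positivity
    have h1 := key n (n - 1) (Or.inl (by exact_mod_cast h))
    -- The factor `√(n + 1)` can exceed the bound only when `n = p + k + 1`, where the component `n
    -- + 1` vanishes.
    have h2 := key (n + 1) (n + 1) (by
      rcases lt_or_ge (p + k) (n + 1) with h' | h'
      · exact Or.inr (generator_pow_fock_eq_zero β p k _ h')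
      · left
        exact_mod_cast (by omega : n + 1 ≤ p + k + 1))
    rw [pow_succ', Module.End.mul_apply, displacementGenerator_apply]
    refine (norm_sub_le _ _).trans ?_
    rw [norm_mul, norm_mul (starRingEnd ℂ β), RCLike.norm_conj]
    calc _ ≤ ‖β‖ * _ + ‖β‖ * _ := add_le_add (mul_le_mul_of_nonneg_left h1 (norm_nonneg _))
          (mul_le_mul_of_nonneg_left h2 (norm_nonneg _))
      _ = (2 * ‖β‖) ^ (k + 1) *
          (Real.sqrt ((p + k + 1 : ℕ)) * Real.sqrt ((p + k).factorial)) := by ring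
      _ = _ := by
        rw [← Real.sqrt_mul (by positivity), ← add_assoc, Nat.factorial_succ, Nat.cast_mul]

/-- From `(p + k)! ≤ 2 ^ (p + k) p! k!`, the square of a term is at most `a b`, with `a` a term of
an exponential series and `b = 2 ^ (-k)`. Hence the term is at most `a + b`. -/
lemma summable_pow_mul_sqrt_factorial_div (x : ℝ) (p : ℕ) :
    Summable fun k : ℕ => x ^ k * Real.sqrt ((p + k).factorial) / (k.factorial : ℝ) := by
  have hs : Summable fun k : ℕ =>
      ((4 * x ^ 2) ^ k / (k.factorial : ℝ)) * (2 ^ p * p.factorial : ℝ) + (1 / 2 : ℝ) ^ k :=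
    ((Real.summable_pow_div_factorial _).mul_right _).add
      (summable_geometric_of_lt_one (by norm_num) (by norm_num))
  refine Summable.of_norm_bounded hs fun k => ?_
  have hk : (0 : ℝ) < k.factorial := by exact_mod_cast k.factorial_pos
  have hfac : ((p + k).factorial : ℝ) ≤ 2 ^ (p + k) * (p.factorial * k.factorial) := by
    have := Nat.add_choose_mul_factorial_mul_factorial p k
    have h2 : (p + k).choose k ≤ 2 ^ (p + k) := Nat.choose_le_two_pow _ _
    rw [← this, mul_assoc, Nat.cast_mul, Nat.cast_mul]
    gcongr
    exact_mod_cast h2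
  have hsq : Real.sqrt ((p + k).factorial) ^ 2 ≤ 2 ^ (p + k) * (p.factorial * k.factorial) := by
    rwa [Real.sq_sqrt (by positivity)]
  rw [norm_div, norm_mul, norm_pow, Real.norm_of_nonneg (Real.sqrt_nonneg _),
    Real.norm_of_nonneg hk.le]
  set y := ‖x‖ ^ k * Real.sqrt ((p + k).factorial) / (k.factorial : ℝ) with hy
  have hy2 : y ^ 2 ≤ ((4 * x ^ 2) ^ k / (k.factorial : ℝ)) * (2 ^ p * p.factorial : ℝ) *
      (1 / 2 : ℝ) ^ k := by
    have e : ((4 * x ^ 2) ^ k / (k.factorial : ℝ)) * (2 ^ p * p.factorial : ℝ) * (1 / 2 : ℝ) ^ k =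
        (‖x‖ ^ k) ^ 2 * (2 ^ (p + k) * (p.factorial * k.factorial)) / (k.factorial : ℝ) ^ 2 := by
      have h4 : (4 : ℝ) ^ k = 2 ^ k * 2 ^ k := by rw [← mul_pow]; norm_num
      have hx2 : (‖x‖ ^ k) ^ 2 = (x ^ 2) ^ k := by
        rw [← pow_mul, mul_comm, pow_mul, Real.norm_eq_abs, sq_abs]
      rw [hx2, mul_pow, h4, one_div, inv_pow, pow_add]
      field_simp
    rw [e, hy, div_pow, mul_pow]
    gcongr
  have ha : 0 ≤ ((4 * x ^ 2) ^ k / (k.factorial : ℝ)) * (2 ^ p * p.factorial : ℝ) := by positivity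
  have hb : 0 ≤ (1 / 2 : ℝ) ^ k := by positivity
  refine le_of_sq_le_sq ?_ (by positivity)
  nlinarith

lemma summable_displacementTerm (β : ℂ) (p n : ℕ) : Summable (displacementTerm β p n) := by
  refine Summable.of_norm_bounded (summable_pow_mul_sqrt_factorial_div (2 * ‖β‖) p) fun k => ?_
  rw [displacementTerm, norm_div, Complex.norm_natCast]
  gcongr
  exact norm_generator_pow_fock_le β p k n

/-- The relation `a D(β) = D(β) (a + β)`. -/
lemma annihilation_displacedFock (β : ℂ) (p n : ℕ) :
    (Real.sqrt (n + 1) : ℂ) * displacedFock β p (n + 1) =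
      (Real.sqrt p : ℂ) * displacedFock β (p - 1) n + β * displacedFock β p n := by
  simp only [displacedFock]
  rw [(summable_displacementTerm β p (n + 1)).tsum_eq_zero_add, mul_add, ← tsum_mul_left,
    (summable_displacementTerm β (p - 1) n).tsum_eq_zero_add, mul_add (Real.sqrt p : ℂ),
    ← tsum_mul_left, ← tsum_mul_left, annihilation_displacementTerm_zero, add_assoc,
    ← Summable.tsum_add]
  · simp only [annihilation_displacementTerm_succ]
  · exact ((summable_nat_add_iff 1).2 (summable_displacementTerm β (p - 1) n)).mul_left _
  · exact (summable_displacementTerm β p n).mul_left _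

/-- The relation `a† D(β) = D(β) (a† + β*)`. -/
lemma creation_displacedFock (β : ℂ) (p n : ℕ) :
    (Real.sqrt n : ℂ) * displacedFock β p (n - 1) =
      (Real.sqrt (p + 1) : ℂ) * displacedFock β (p + 1) n +
        starRingEnd ℂ β * displacedFock β p n := by
  simp only [displacedFock]
  rw [(summable_displacementTerm β p (n - 1)).tsum_eq_zero_add, mul_add, ← tsum_mul_left,
    (summable_displacementTerm β (p + 1) n).tsum_eq_zero_add, mul_add (Real.sqrt (p + 1) : ℂ),
    ← tsum_mul_left, ← tsum_mul_left, creation_displacementTerm_zero, add_assoc,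
    ← Summable.tsum_add]
  · simp only [creation_displacementTerm_succ]
  · exact ((summable_nat_add_iff 1).2 (summable_displacementTerm β (p + 1) n)).mul_left _
  · exact (summable_displacementTerm β p n).mul_left _

/-! ### Vacuum amplitude and polynomial growth in `p` -/

/-- Since `⟨0|A = -β*⟨1|`, peeling one generator off the left leads to the component along `|1⟩`;
commuting `a` through the remaining power returns to `⟨0|`. -/
lemma displacementTerm_vacuum_add_two (β : ℂ) (k : ℕ) :
    ((k : ℂ) + 2) * displacementTerm β 0 0 (k + 2) =
      -(β * starRingEnd ℂ β) * displacementTerm β 0 0 k := by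
  have h1 := creation_displacementTerm_succ β 0 0 (k + 1)
  have h2 := annihilation_displacementTerm_succ β 0 0 k
  have h3 : displacementTerm β 0 0 (k + 2) =
      -(starRingEnd ℂ β) * displacementTerm β 0 1 (k + 1) / (k + 2) := by
    have hk : (k.factorial : ℂ) ≠ 0 := Nat.cast_ne_zero.2 k.factorial_ne_zero
    have hk1 : ((k : ℂ) + 1) ≠ 0 := Nat.cast_add_one_ne_zero k
    have hk2 : ((k : ℂ) + 2) ≠ 0 := by exact_mod_cast Nat.succ_ne_zero (k + 1)
    rw [displacementTerm, pow_succ', Module.End.mul_apply, displacementGenerator_apply,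
      displacementTerm, Nat.factorial_succ (k + 1), Nat.factorial_succ k]
    push_cast
    simp
    field_simp
    ring
  have hk2 : ((k : ℂ) + 2) ≠ 0 := by exact_mod_cast Nat.succ_ne_zero (k + 1)
  simp at h2
  rw [h3, h2]
  field_simp

lemma displacedFock_vacuum (β : ℂ) :
    displacedFock β 0 0 = Complex.exp (-(β * starRingEnd ℂ β) / 2) := by
  have heven (j : ℕ) : displacementTerm β 0 0 (2 * j) =
      (-(β * starRingEnd ℂ β) / 2) ^ j / (j.factorial : ℂ) := by
    induction j with
    | zero => simp [displacementTerm_zero, fock]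
    | succ j ih =>
      have h := displacementTerm_vacuum_add_two β (2 * j)
      have hj : ((j : ℂ) + 1) ≠ 0 := Nat.cast_add_one_ne_zero j
      have hj' : (j.factorial : ℂ) ≠ 0 := Nat.cast_ne_zero.2 j.factorial_ne_zero
      rw [ih] at h
      rw [show 2 * (j + 1) = 2 * j + 2 by ring, Nat.factorial_succ, pow_succ]
      apply mul_left_cancel₀ (mul_ne_zero two_ne_zero hj)
      push_cast at h ⊢
      rw [show (2 : ℂ) * (j + 1) = 2 * j + 2 by ring, h]
      field_simp
  have hodd (j : ℕ) : displacementTerm β 0 0 (2 * j + 1) = 0 := by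
    induction j with
    | zero => simp [displacementTerm, displacementGenerator_apply, fock]
    | succ j ih =>
      have h := displacementTerm_vacuum_add_two β (2 * j + 1)
      rw [ih, mul_zero] at h
      refine (mul_eq_zero.1 h).resolve_left ?_
      exact_mod_cast Nat.succ_ne_zero (2 * j + 1 + 1)
  have h1 : HasSum (fun j => displacementTerm β 0 0 (2 * j))
      (Complex.exp (-(β * starRingEnd ℂ β) / 2)) := by
    simp only [heven, Complex.exp_eq_exp_ℂ]
    exact NormedSpace.expSeries_div_hasSum_exp _
  have h2 : HasSum (fun j => displacementTerm β 0 0 (2 * j + 1)) 0 := by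
    simp only [hodd]
    exact hasSum_zero
  have h := (h1.even_add_odd h2).tsum_eq
  rwa [add_zero] at h

/-- At `n = 0` the relation for `a†` loses its left side, so `|⟨0|p, β⟩|²` is a Poisson weight in
`p`, up to a constant. -/
lemma exists_norm_displacedFock_zero_le (β : ℂ) : ∃ C : ℝ, 0 ≤ C ∧
    ∀ p, ‖displacedFock β p 0‖ ≤ C := by
  have hrec (p : ℕ) : ‖displacedFock β p 0‖ ^ 2 * p.factorial =
      ‖displacedFock β 0 0‖ ^ 2 * (‖β‖ ^ 2) ^ p := by
    induction p with
    | zero => simp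
    | succ p ih =>
      have h := creation_displacedFock β p 0
      rw [Nat.cast_zero, Real.sqrt_zero, Complex.ofReal_zero, zero_mul] at h
      have h1 : ‖(Real.sqrt (p + 1) : ℂ) * displacedFock β (p + 1) 0‖ =
          ‖starRingEnd ℂ β * displacedFock β p 0‖ := by
        rw [← norm_neg, neg_eq_of_add_eq_zero_right h.symm]
      rw [norm_mul, norm_mul, RCLike.norm_conj, Complex.norm_real,
        Real.norm_of_nonneg (Real.sqrt_nonneg _)] at h1
      have h2 := congrArg (· ^ 2) h1
      simp only [mul_pow] at h2
      rw [Real.sq_sqrt (by positivity)] at h2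
      rw [Nat.factorial_succ, pow_succ]
      push_cast
      linear_combination (p.factorial : ℝ) * h2 + ‖β‖ ^ 2 * ih
  refine ⟨Real.sqrt (‖displacedFock β 0 0‖ ^ 2 * Real.exp (‖β‖ ^ 2)), Real.sqrt_nonneg _,
    fun p => Real.le_sqrt_of_sq_le ?_⟩
  have hp : (0 : ℝ) < p.factorial := by exact_mod_cast p.factorial_pos
  rw [eq_div_of_mul_eq hp.ne' (hrec p), mul_div_assoc]
  gcongr
  exact Real.pow_div_factorial_le_exp _ (by positivity) p

lemma exists_norm_displacedFock_le (β : ℂ) (n : ℕ) : ∃ C : ℝ, 0 ≤ C ∧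
    ∀ p, ‖displacedFock β p n‖ ≤ C * ((p : ℝ) + 1) ^ n := by
  induction n with
  | zero => simpa using exists_norm_displacedFock_zero_le β
  | succ n ih =>
    obtain ⟨C, hC, h⟩ := ih
    refine ⟨C * (1 + ‖β‖), by positivity, fun p => ?_⟩
    have h1 : ‖displacedFock β p (n + 1)‖ ≤
        ‖(Real.sqrt (n + 1) : ℂ) * displacedFock β p (n + 1)‖ := by
      rw [norm_mul, Complex.norm_real, Real.norm_of_nonneg (Real.sqrt_nonneg _)]
      exact le_mul_of_one_le_left (norm_nonneg _) (Real.one_le_sqrt.2 (by simp))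
    have hsq : Real.sqrt p ≤ (p : ℝ) + 1 :=
      Real.sqrt_le_iff.2 ⟨by positivity, by nlinarith [(Nat.cast_nonneg p : (0 : ℝ) ≤ p)]⟩
    have hp1 : ((p - 1 : ℕ) : ℝ) ≤ p := by exact_mod_cast Nat.sub_le p 1
    have hone : (1 : ℝ) ≤ (p : ℝ) + 1 := by simp
    rw [annihilation_displacedFock] at h1
    calc _ ≤ _ := h1
      _ ≤ ‖(Real.sqrt p : ℂ) * displacedFock β (p - 1) n‖ + ‖β * displacedFock β p n‖ :=
        norm_add_le _ _
      _ = Real.sqrt p * ‖displacedFock β (p - 1) n‖ + ‖β‖ * ‖displacedFock β p n‖ := by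
        rw [norm_mul, norm_mul, Complex.norm_real, Real.norm_of_nonneg (Real.sqrt_nonneg _)]
      _ ≤ ((p : ℝ) + 1) * (C * ((p : ℝ) + 1) ^ n) +
          ‖β‖ * (((p : ℝ) + 1) * (C * ((p : ℝ) + 1) ^ n)) := by
        gcongr
        · refine (h _).trans ?_
          gcongr
        · exact (h p).trans (le_mul_of_one_le_left (by positivity) hone)
      _ = C * (1 + ‖β‖) * ((p : ℝ) + 1) ^ (n + 1) := by ring

/-! ### Thermal matrix elements -/

/-- The contribution of `p` to the matrix element `⟨n|D(β) Θ^N D(β)†|m⟩` of one mode. -/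
noncomputable def modeTerm (β : ℂ) (Θ : ℝ) (n m p : ℕ) : ℂ :=
  (Θ : ℂ) ^ p * (displacedFock β p n * starRingEnd ℂ (displacedFock β p m))

/-- The matrix element `⟨n|D(β) Θ^N D(β)†|m⟩` of one mode. -/
noncomputable def modeMatrix (β : ℂ) (Θ : ℝ) (n m : ℕ) : ℂ := ∑' p, modeTerm β Θ n m p

lemma summable_norm_modeTerm (β : ℂ) {Θ : ℝ} (hΘ₀ : 0 ≤ Θ) (hΘ₁ : Θ < 1) (n m : ℕ) :
    Summable fun p => ‖modeTerm β Θ n m p‖ := by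
  obtain ⟨C, hC, h⟩ := exists_norm_displacedFock_le β n
  obtain ⟨C', hC', h'⟩ := exists_norm_displacedFock_le β m
  have hs : Summable fun p : ℕ => C * C' * 2 ^ (n + m) * ((p : ℝ) ^ (n + m) * Θ ^ p + Θ ^ p) :=
    ((summable_pow_mul_geometric_of_norm_lt_one (n + m)
      (by rwa [Real.norm_of_nonneg hΘ₀])).add
        (summable_geometric_of_lt_one hΘ₀ hΘ₁)).mul_left _
  refine Summable.of_nonneg_of_le (fun _ => norm_nonneg _) (fun p => ?_) hs
  -- The summand 1 on the right is needed at `p = 0`, where `p + 1 ≤ 2 p` fails.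
  have hpow : ((p : ℝ) + 1) ^ (n + m) ≤ 2 ^ (n + m) * ((p : ℝ) ^ (n + m) + 1) := by
    rcases p with _ | p
    · have h2 : (1 : ℝ) ≤ 2 ^ (n + m) := one_le_pow₀ (by norm_num)
      have h3 : (0 : ℝ) ≤ ((0 : ℕ) : ℝ) ^ (n + m) := by positivity
      have h4 : ((0 : ℕ) + 1 : ℝ) ^ (n + m) = 1 := by simp
      rw [Nat.cast_zero, zero_add, one_pow]
      rw [Nat.cast_zero] at h3
      nlinarith
    · calc (((p + 1 : ℕ) : ℝ) + 1) ^ (n + m) ≤ (2 * ((p + 1 : ℕ) : ℝ)) ^ (n + m) := by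
            gcongr
            push_cast
            linarith [(Nat.cast_nonneg p : (0 : ℝ) ≤ p)]
        _ = 2 ^ (n + m) * ((p + 1 : ℕ) : ℝ) ^ (n + m) := mul_pow _ _ _
        _ ≤ _ := by gcongr; simp
  rw [modeTerm, norm_mul, norm_mul, RCLike.norm_conj, norm_pow, Complex.norm_real,
    Real.norm_of_nonneg hΘ₀]
  calc Θ ^ p * (‖displacedFock β p n‖ * ‖displacedFock β p m‖)
      ≤ Θ ^ p * ((C * ((p : ℝ) + 1) ^ n) * (C' * ((p : ℝ) + 1) ^ m)) := by
        gcongr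
        · exact h p
        · exact h' p
    _ = C * C' * Θ ^ p * ((p : ℝ) + 1) ^ (n + m) := by rw [pow_add]; ring
    _ ≤ C * C' * Θ ^ p * (2 ^ (n + m) * ((p : ℝ) ^ (n + m) + 1)) := by gcongr
    _ = _ := by ring

lemma summable_modeTerm (β : ℂ) {Θ : ℝ} (hΘ₀ : 0 ≤ Θ) (hΘ₁ : Θ < 1) (n m : ℕ) :
    Summable (modeTerm β Θ n m) :=
  (summable_norm_modeTerm β hΘ₀ hΘ₁ n m).of_norm

lemma conj_modeMatrix (β : ℂ) (Θ : ℝ) (n m : ℕ) :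
    starRingEnd ℂ (modeMatrix β Θ n m) = modeMatrix β Θ m n := by
  rw [modeMatrix, modeMatrix, Complex.conj_tsum]
  refine tsum_congr fun p => ?_
  simp [modeTerm, mul_comm]

/-- The sum of `Θ ^ p √p ⟨n|p - 1, β⟩ ⟨m|p, β⟩*` is evaluated in two ways: by the relation for `a`,
and, after shifting `p` by one, by the conjugate relation for `a†`. The shift produces the factor
`Θ`. -/
lemma sqrt_mul_modeMatrix_succ (β : ℂ) {Θ : ℝ} (hΘ₀ : 0 ≤ Θ) (hΘ₁ : Θ < 1) (n m : ℕ) :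
    (Real.sqrt (n + 1) : ℂ) * modeMatrix β Θ (n + 1) m =
      Θ * (Real.sqrt m : ℂ) * modeMatrix β Θ n (m - 1) + (1 - Θ) * β * modeMatrix β Θ n m := by
  have hs := summable_modeTerm β hΘ₀ hΘ₁
  set f : ℕ → ℂ := fun p => (Θ : ℂ) ^ p * ((Real.sqrt p : ℂ) * displacedFock β (p - 1) n *
    starRingEnd ℂ (displacedFock β p m)) with hf
  have hfeq (p : ℕ) : f p =
      (Real.sqrt (n + 1) : ℂ) * modeTerm β Θ (n + 1) m p - β * modeTerm β Θ n m p := by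
    have h := annihilation_displacedFock β p n
    simp only [hf, modeTerm]
    linear_combination (-(Θ : ℂ) ^ p * starRingEnd ℂ (displacedFock β p m)) * h
  have hfs : Summable f := by
    rw [show f = _ from funext hfeq]
    exact ((hs _ _).mul_left _).sub ((hs _ _).mul_left _)
  have h1 : ∑' p, f p =
      (Real.sqrt (n + 1) : ℂ) * modeMatrix β Θ (n + 1) m - β * modeMatrix β Θ n m := by
    simp only [hfeq, modeMatrix]
    rw [Summable.tsum_sub ((hs _ _).mul_left _) ((hs _ _).mul_left _), tsum_mul_left,
      tsum_mul_left]
  have h2 : ∑' p, f p =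
      Θ * ((Real.sqrt m : ℂ) * modeMatrix β Θ n (m - 1)) - Θ * (β * modeMatrix β Θ n m) := by
    have hsucc (p : ℕ) : f (p + 1) =
        Θ * ((Real.sqrt m : ℂ) * modeTerm β Θ n (m - 1) p) - Θ * (β * modeTerm β Θ n m p) := by
      have h := congrArg (starRingEnd ℂ) (creation_displacedFock β p m)
      simp only [map_mul, map_add, Complex.conj_ofReal, Complex.conj_conj] at h
      simp only [hf, modeTerm, Nat.add_sub_cancel]
      push_cast
      linear_combination (-(Θ : ℂ) ^ (p + 1) * displacedFock β p n) * h
    rw [hfs.tsum_eq_zero_add]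
    simp only [hsucc, modeMatrix]
    rw [Summable.tsum_sub (((hs _ _).mul_left _).mul_left _) (((hs _ _).mul_left _).mul_left _),
      tsum_mul_left, tsum_mul_left, tsum_mul_left, tsum_mul_left]
    simp [hf]
  linear_combination h2 - h1

lemma modeMatrix_zero_zero (β : ℂ) {Θ : ℝ} (hΘ₀ : 0 ≤ Θ) (hΘ₁ : Θ < 1) :
    ∃ c : ℝ, 0 < c ∧ modeMatrix β Θ 0 0 = c := by
  have heq (p : ℕ) : modeTerm β Θ 0 0 p = ((Θ ^ p * ‖displacedFock β p 0‖ ^ 2 : ℝ) : ℂ) := by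
    rw [modeTerm, Complex.mul_conj']
    push_cast
    rfl
  have hs : Summable fun p => Θ ^ p * ‖displacedFock β p 0‖ ^ 2 := by
    have h := summable_modeTerm β hΘ₀ hΘ₁ 0 0
    rw [show modeTerm β Θ 0 0 = _ from funext heq] at h
    exact_mod_cast h
  -- The term `p = 0` is positive even for `Θ = 0`, because `0 ^ 0 = 1` and the vacuum amplitude is
  -- an exponential.
  refine ⟨∑' p, Θ ^ p * ‖displacedFock β p 0‖ ^ 2, hs.tsum_pos (fun p => by positivity) 0 ?_, ?_⟩
  · have : displacedFock β 0 0 ≠ 0 := by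
      rw [displacedFock_vacuum]
      exact Complex.exp_ne_zero _
    positivity
  · rw [Complex.ofReal_tsum]
    exact tsum_congr heq

lemma partitionFunction_pos {Θ : ℝ} (hΘ₀ : 0 ≤ Θ) (hΘ₁ : Θ < 1) : 0 < partitionFunction Θ := by
  rw [partitionFunction, tsum_geometric_of_lt_one hΘ₀ hΘ₁]
  exact inv_pos.2 (sub_pos.2 hΘ₁)

lemma thermalTerm_eq (β : ℂ) (Θ : ℝ) (n m p : ℕ × ℕ) :
    thermalTerm β β Θ Θ n m p = ((partitionFunction Θ : ℂ) ^ 2)⁻¹ *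
      (modeTerm β Θ n.1 m.1 p.1 * modeTerm β Θ n.2 m.2 p.2) := by
  simp only [thermalTerm, modeTerm, displacedFock₂, map_mul]
  push_cast
  ring

lemma summable_thermalTerm (β : ℂ) {Θ : ℝ} (hΘ₀ : 0 ≤ Θ) (hΘ₁ : Θ < 1) (n m : ℕ × ℕ) :
    Summable (thermalTerm β β Θ Θ n m) := by
  rw [show thermalTerm β β Θ Θ n m = _ from funext (thermalTerm_eq β Θ n m)]
  exact (summable_mul_of_summable_norm (summable_norm_modeTerm β hΘ₀ hΘ₁ n.1 m.1)
    (summable_norm_modeTerm β hΘ₀ hΘ₁ n.2 m.2)).mul_left _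

lemma displacedThermal_apply (β : ℂ) {Θ : ℝ} (hΘ₀ : 0 ≤ Θ) (hΘ₁ : Θ < 1) (n m : ℕ × ℕ) :
    displacedThermal β β Θ Θ n m = ((partitionFunction Θ : ℂ) ^ 2)⁻¹ *
      (modeMatrix β Θ n.1 m.1 * modeMatrix β Θ n.2 m.2) := by
  rw [displacedThermal, modeMatrix, modeMatrix,
    tsum_mul_tsum_of_summable_norm (summable_norm_modeTerm β hΘ₀ hΘ₁ n.1 m.1)
    (summable_norm_modeTerm β hΘ₀ hΘ₁ n.2 m.2), ← tsum_mul_left]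
  exact tsum_congr (thermalTerm_eq β Θ n m)

/-! ### A finite ensemble with the moments of a complex Gaussian -/

/-- Points of a five-point ensemble whose moments `E[z^j z*^k]`, `j, k ≤ 2`, are those of a
standard complex Gaussian variable, scaled by `√(1/2)`. -/
noncomputable def ensemblePoint : Fin 5 → ℂ := ![0, 1, Complex.I, -1, -Complex.I]

/-- The weights of the five-point ensemble. -/
noncomputable def ensembleWeight : Fin 5 → ℝ := ![1 / 2, 1 / 8, 1 / 8, 1 / 8, 1 / 8]

/-- The five amplitudes replacing the Gaussian distribution of coherent amplitudes. -/
noncomputable def amplitude (β : ℂ) (Θ : ℝ) (i : Fin 5) : ℂ :=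
  (1 - Θ) * β + (Real.sqrt (Θ * 2) : ℂ) * ensemblePoint i

lemma ensembleWeight_pos (i : Fin 5) : 0 < ensembleWeight i := by
  fin_cases i <;> simp [ensembleWeight]

/-- The matrix elements of `D(β) Θ^N D(β)†` in the basis `√(n!) |n⟩`. -/
noncomputable def scaledModeMatrix (β : ℂ) (Θ : ℝ) (n m : ℕ) : ℂ :=
  (Real.sqrt n.factorial : ℂ) * (Real.sqrt m.factorial : ℂ) * modeMatrix β Θ n m

lemma conj_scaledModeMatrix (β : ℂ) (Θ : ℝ) (n m : ℕ) :
    starRingEnd ℂ (scaledModeMatrix β Θ n m) = scaledModeMatrix β Θ m n := by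
  simp only [scaledModeMatrix, map_mul, Complex.conj_ofReal, conj_modeMatrix]
  ring

lemma ofReal_sqrt_factorial_succ (n : ℕ) :
    (Real.sqrt (n + 1).factorial : ℂ) =
      (Real.sqrt (n + 1) : ℂ) * (Real.sqrt n.factorial : ℂ) := by
  rw [Nat.factorial_succ, Nat.cast_mul, Real.sqrt_mul (by positivity)]
  push_cast
  rfl

/-- This is Gaussian integration by parts for the moments `E[z^n z*^m]` with mean `(1 - Θ) β` and
variance `Θ`. -/
lemma scaledModeMatrix_succ (β : ℂ) {Θ : ℝ} (hΘ₀ : 0 ≤ Θ) (hΘ₁ : Θ < 1) (n m : ℕ) :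
    scaledModeMatrix β Θ (n + 1) m =
      Θ * m * scaledModeMatrix β Θ n (m - 1) + (1 - Θ) * β * scaledModeMatrix β Θ n m := by
  have h := sqrt_mul_modeMatrix_succ β hΘ₀ hΘ₁ n m
  have hm : (Real.sqrt m.factorial : ℂ) * (Real.sqrt m : ℂ) =
      m * (Real.sqrt (m - 1).factorial : ℂ) := by
    rcases m with _ | m
    · simp
    · have h1 := ofReal_sqrt_mul_self (x := (m : ℝ) + 1) (by positivity)
      rw [ofReal_sqrt_factorial_succ, Nat.add_sub_cancel]
      push_cast at h1 ⊢
      linear_combination (Real.sqrt m.factorial : ℂ) * h1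
  simp only [scaledModeMatrix, ofReal_sqrt_factorial_succ]
  linear_combination (Real.sqrt n.factorial : ℂ) * (Real.sqrt m.factorial : ℂ) * h +
    Θ * (Real.sqrt n.factorial : ℂ) * modeMatrix β Θ n (m - 1) * hm

lemma scaledModeMatrix_eq_moment (β : ℂ) {Θ : ℝ} (hΘ₀ : 0 ≤ Θ) (hΘ₁ : Θ < 1) {n m : ℕ}
    (hn : n ≤ 2) (hm : m ≤ 2) :
    scaledModeMatrix β Θ n m =
      modeMatrix β Θ 0 0 * ∑ i, (ensembleWeight i : ℂ) *
        (amplitude β Θ i ^ n * starRingEnd ℂ (amplitude β Θ i) ^ m) := by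
  have hrec := scaledModeMatrix_succ β hΘ₀ hΘ₁
  have hconj := conj_scaledModeMatrix β Θ
  have hs : (Real.sqrt (Θ * 2) : ℂ) ^ 2 = 2 * Θ := by
    rw [sq, ofReal_sqrt_mul_self (by positivity)]
    push_cast
    ring
  have hs4 : (Real.sqrt (Θ * 2) : ℂ) ^ 4 = 4 * Θ ^ 2 := by
    linear_combination ((Real.sqrt (Θ * 2) : ℂ) ^ 2 + Θ * 2) * hs
  have h00 : scaledModeMatrix β Θ 0 0 = modeMatrix β Θ 0 0 := by simp [scaledModeMatrix]
  have c00 : starRingEnd ℂ (modeMatrix β Θ 0 0) = modeMatrix β Θ 0 0 := conj_modeMatrix β Θ 0 0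
  have h10 := hrec 0 0
  have h20 := hrec 1 0
  have h11 := hrec 0 1
  have h21 := hrec 1 1
  have h12 := hrec 0 2
  have h22 := hrec 1 2
  have h01 := hconj 1 0
  have h02 := hconj 2 0
  norm_num [h00] at h10 h20 h11 h21 h12 h22
  simp only [h10, h20, map_mul, map_sub, map_one, Complex.conj_ofReal, c00] at h01 h02
  rw [← h01] at h11 h12
  rw [← h02] at h12
  rw [h10, h11] at h21
  rw [h11, h12] at h22
  rw [h10] at h20
  -- The recurrence and conjugation symmetry have reduced each of the nine entries to a polynomial
  -- times the vacuum element; it remains to expand the five-point sums.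
  interval_cases n <;> interval_cases m <;>
    simp only [h00, ← h01, ← h02, h10, h11, h12, h20, h21, h22, Fin.sum_univ_five, amplitude,
      ensembleWeight, ensemblePoint, Matrix.cons_val, map_mul, map_sub, map_add, map_one,
      map_neg, map_zero, Complex.conj_ofReal, Complex.conj_I] <;>
    push_cast <;> ring_nf <;>
    simp only [Complex.I_sq, Complex.I_pow_four, hs, hs4] <;> ring

/-! ### Separable states -/

/-- The operator `|v⟩⟨v|` of one particle. -/
def dyad (v : Fin 2 → ℂ) : Matrix (Fin 2) (Fin 2) ℂ := Matrix.vecMulVec v (star v)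

lemma posSemidef_dyad (v : Fin 2 → ℂ) : (dyad v).PosSemidef :=
  Matrix.posSemidef_vecMulVec_self_star v

/-- The squared norm of a one-particle vector. -/
noncomputable def sqNorm (v : Fin 2 → ℂ) : ℝ := ‖v 0‖ ^ 2 + ‖v 1‖ ^ 2

lemma sqNorm_nonneg (v : Fin 2 → ℂ) : 0 ≤ sqNorm v := by
  unfold sqNorm
  positivity

lemma trace_dyad (v : Fin 2 → ℂ) : (dyad v).trace = sqNorm v := by
  simp [dyad, sqNorm, Matrix.trace, Matrix.vecMulVec_apply, Complex.mul_conj']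

lemma dyad_eq_zero {v : Fin 2 → ℂ} (h : sqNorm v = 0) : dyad v = 0 := by
  unfold sqNorm at h
  have h0 : ‖v 0‖ ^ 2 = 0 := by nlinarith [sq_nonneg ‖v 0‖, sq_nonneg ‖v 1‖]
  have h1 : ‖v 1‖ ^ 2 = 0 := by nlinarith [sq_nonneg ‖v 0‖, sq_nonneg ‖v 1‖]
  have hv : v = 0 := by
    ext a
    fin_cases a
    · simpa using h0
    · simpa using h1
  ext a b
  simp [dyad, hv, Matrix.vecMulVec_apply]

lemma exists_isDensityMatrix_dyad (v : Fin 2 → ℂ) :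
    ∃ σ, IsDensityMatrix σ ∧ dyad v = (sqNorm v : ℂ) • σ := by
  by_cases h : sqNorm v = 0
  -- For the zero vector any density matrix serves, since its coefficient is zero.
  · refine ⟨dyad ![1, 0], ⟨posSemidef_dyad _, ?_⟩, ?_⟩
    · simp [trace_dyad, sqNorm]
    · simp [h, dyad_eq_zero h]
  · have hC : (sqNorm v : ℂ) ≠ 0 := Complex.ofReal_ne_zero.2 h
    refine ⟨((sqNorm v)⁻¹ : ℂ) • dyad v, ⟨(posSemidef_dyad v).smul ?_, ?_⟩, ?_⟩
    · rw [← Complex.ofReal_inv, Complex.zero_le_real]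
      exact inv_nonneg.2 (sqNorm_nonneg v)
    · rw [Matrix.trace_smul, trace_dyad, smul_eq_mul, inv_mul_cancel₀ hC]
    · rw [smul_smul, mul_inv_cancel₀ hC, one_smul]

/-- The positive combination `∑ₖ wₖ |vₖ⟩⟨vₖ| ⊗ |vₖ⟩⟨vₖ|` of product operators. -/
def productMixture {ι : Type*} [Fintype ι] (w : ι → ℝ) (v : ι → Fin 2 → ℂ) :
    Matrix (Fin 2 × Fin 2) (Fin 2 × Fin 2) ℂ :=
  ∑ k, (w k : ℂ) • (dyad (v k) ⊗ₖ dyad (v k))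

lemma trace_productMixture {ι : Type*} [Fintype ι] (w : ι → ℝ) (v : ι → Fin 2 → ℂ) :
    (productMixture w v).trace = ((∑ k, w k * sqNorm (v k) ^ 2 : ℝ) : ℂ) := by
  simp only [productMixture, Matrix.trace_sum, Matrix.trace_smul, Matrix.trace_kronecker,
    trace_dyad, smul_eq_mul]
  push_cast
  simp only [sq]

lemma isSeparable_normalised_productMixture {ι : Type*} [Fintype ι] {w : ι → ℝ}
    {v : ι → Fin 2 → ℂ} (hw : ∀ k, 0 ≤ w k) (ht : 0 < ∑ k, w k * sqNorm (v k) ^ 2) :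
    IsSeparable ((productMixture w v).trace⁻¹ • productMixture w v) := by
  rw [trace_productMixture]
  set t := ∑ k, w k * sqNorm (v k) ^ 2 with htdef
  choose σ hσ hv using fun k => exists_isDensityMatrix_dyad (v k)
  let e := Fintype.equivFin ι
  refine ⟨Fintype.card ι, fun i => t⁻¹ * (w (e.symm i) * sqNorm (v (e.symm i)) ^ 2),
    fun i => σ (e.symm i), fun i => σ (e.symm i), fun i => ?_, ?_, fun i => hσ _, fun i => hσ _, ?_⟩
  · have := hw (e.symm i)
    positivity
  · rw [e.symm.sum_comp fun k => t⁻¹ * (w k * sqNorm (v k) ^ 2), ← Finset.mul_sum, ← htdef,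
      inv_mul_cancel₀ ht.ne']
  · rw [e.symm.sum_comp fun k =>
      ((t⁻¹ * (w k * sqNorm (v k) ^ 2) : ℝ) : ℂ) • (σ k ⊗ₖ σ k), productMixture, Finset.smul_sum]
    refine Finset.sum_congr rfl fun k _ => ?_
    rw [hv k, Matrix.smul_kronecker, Matrix.kronecker_smul, smul_smul, smul_smul, smul_smul]
    congr 1
    push_cast
    ring

lemma IsSeparable.isDensityMatrix {ρ : Matrix (Fin 2 × Fin 2) (Fin 2 × Fin 2) ℂ}
    (h : IsSeparable ρ) : IsDensityMatrix ρ := by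
  obtain ⟨N, w, σ, τ, hw, hw1, hσ, hτ, rfl⟩ := h
  refine ⟨Matrix.posSemidef_sum _ fun i _ =>
    ((hσ i).1.kronecker (hτ i).1).smul (Complex.zero_le_real.2 (hw i)), ?_⟩
  simp only [Matrix.trace_sum, Matrix.trace_smul, Matrix.trace_kronecker, (hσ _).2, (hτ _).2,
    mul_one, smul_eq_mul]
  exact_mod_cast hw1

lemma partialTranspose_sum_kronecker {ι : Type*} [Fintype ι] (w : ι → ℝ)
    (σ τ : ι → Matrix (Fin 2) (Fin 2) ℂ) :
    partialTranspose (∑ k, (w k : ℂ) • (σ k ⊗ₖ τ k)) =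
      ∑ k, (w k : ℂ) • (σ k ⊗ₖ (τ k).transpose) := by
  ext x y
  simp [partialTranspose, Matrix.sum_apply]

lemma IsSeparable.posSemidef_partialTranspose {ρ : Matrix (Fin 2 × Fin 2) (Fin 2 × Fin 2) ℂ}
    (h : IsSeparable ρ) : (partialTranspose ρ).PosSemidef := by
  obtain ⟨N, w, σ, τ, hw, hw1, hσ, hτ, rfl⟩ := h
  rw [partialTranspose_sum_kronecker]
  exact Matrix.posSemidef_sum _ fun i _ =>
    ((hσ i).1.kronecker (hτ i).1.transpose).smul (Complex.zero_le_real.2 (hw i))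

/-- The transpose of `|v⟩⟨v|` is `|v*⟩⟨v*|`, so the operator is the projector, up to scale, onto `v
⊗ v*`. -/
lemma quadraticForm_dyad_kronecker_transpose (v : Fin 2 → ℂ) (x : Fin 2 × Fin 2 → ℂ) :
    star x ⬝ᵥ (dyad v ⊗ₖ (dyad v).transpose).mulVec x =
      ((‖∑ a, ∑ b, x (a, b) * (star (v a) * v b)‖ ^ 2 : ℝ) : ℂ) := by
  push_cast
  rw [← Complex.mul_conj']
  simp [dotProduct, Matrix.mulVec, Fintype.sum_prod_type, dyad, Matrix.vecMulVec_apply,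
    Fin.sum_univ_two]
  ring

lemma posDef_partialTranspose_productMixture {ι : Type*} [Fintype ι] {w : ι → ℝ}
    {v : ι → Fin 2 → ℂ} (hw : ∀ k, 0 < w k)
    (hv : ∀ x : Fin 2 × Fin 2 → ℂ,
      (∀ k, ∑ a, ∑ b, x (a, b) * (star (v k a) * v k b) = 0) → x = 0) :
    (partialTranspose (productMixture w v)).PosDef := by
  rw [productMixture, partialTranspose_sum_kronecker]
  refine Matrix.PosDef.of_dotProduct_mulVec_pos ?_ fun x hx => ?_
  · exact (Matrix.posSemidef_sum _ fun k _ =>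
      ((posSemidef_dyad (v k)).kronecker (posSemidef_dyad (v k)).transpose).smul
        (Complex.zero_le_real.2 (hw k).le)).isHermitian
  · simp only [Matrix.sum_mulVec, dotProduct_sum, Matrix.smul_mulVec, dotProduct_smul,
      quadraticForm_dyad_kronecker_transpose, smul_eq_mul]
    rw [← Complex.ofReal_zero]
    simp only [← Complex.ofReal_mul]
    rw [← Complex.ofReal_sum, Complex.real_lt_real]
    obtain ⟨k, hk⟩ : ∃ k, ∑ a, ∑ b, x (a, b) * (star (v k a) * v k b) ≠ 0 := by
      by_contra! h
      exact hx (hv x h)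
    refine Finset.sum_pos' (fun k _ => mul_nonneg (hw k).le (sq_nonneg _)) ⟨k, Finset.mem_univ k, ?_⟩
    exact mul_pos (hw k) (pow_pos (norm_pos_iff.2 hk) 2)

/-! ### The two-photon component -/

/-- The normalisation of `firstQuantisation` on the Fock state occupied by `x`. -/
noncomputable def symmetryFactor (x : Fin 2 × Fin 2) : ℂ :=
  if occupation x = (1, 1) then ((1 / Real.sqrt 2 : ℝ) : ℂ) else 1

lemma occupation_mem_antidiagonal (x : Fin 2 × Fin 2) :
    occupation x ∈ Finset.HasAntidiagonal.antidiagonal 2 := by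
  revert x
  decide

lemma twoParticleMatrix_apply (ρ : Matrix (ℕ × ℕ) (ℕ × ℕ) ℂ) (x y : Fin 2 × Fin 2) :
    twoParticleMatrix ρ x y =
      symmetryFactor x * symmetryFactor y * ρ (occupation x) (occupation y) := by
  have hF (z : Fin 2 × Fin 2) (n : TwoPhoton) : firstQuantisation z n =
      if n = ⟨occupation z, occupation_mem_antidiagonal z⟩ then symmetryFactor z else 0 := by
    by_cases h : occupation z = n.1
    · have h' : n = ⟨occupation z, occupation_mem_antidiagonal z⟩ := Subtype.ext h.symm
      rw [if_pos h', firstQuantisation, if_pos h, symmetryFactor, h]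
    · have h' : n ≠ ⟨occupation z, occupation_mem_antidiagonal z⟩ := fun e => h (by rw [e])
      rw [if_neg h', firstQuantisation, if_neg h]
  have hstar (z : Fin 2 × Fin 2) : star (symmetryFactor z) = symmetryFactor z := by
    rw [symmetryFactor]
    split_ifs <;> simp
  simp only [twoParticleMatrix, Matrix.mul_apply, Matrix.conjTranspose_apply, hF,
    apply_ite star, star_zero, hstar, ite_mul, zero_mul, mul_ite, mul_zero, Finset.sum_ite_eq',
    Finset.mem_univ, if_true, restrictTwoPhoton, Matrix.submatrix_apply]
  ring

/-- The isometry thus supplies exactly the rescaling `√(n₁! n₂!)` that turns matrix elements into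
moments, up to the constant `√2`. -/
lemma sqrt_two_mul_symmetryFactor (x : Fin 2 × Fin 2) :
    (Real.sqrt 2 : ℂ) * symmetryFactor x = (Real.sqrt (occupation x).1.factorial : ℂ) *
      (Real.sqrt (occupation x).2.factorial : ℂ) := by
  have h : (Real.sqrt 2 : ℂ) ≠ 0 := ofReal_sqrt_ne_zero (by norm_num)
  obtain ⟨a, b⟩ := x
  fin_cases a <;> fin_cases b <;> simp [symmetryFactor, occupation, h]

lemma pow_occupation (x : Fin 2 × Fin 2) (α α' : ℂ) :
    α ^ (occupation x).1 * α' ^ (occupation x).2 = ![α, α'] x.1 * ![α, α'] x.2 := by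
  obtain ⟨a, b⟩ := x
  fin_cases a <;> fin_cases b <;> simp [occupation, sq, mul_comm]

/-- The one-particle vectors `(α, α')` formed from two amplitudes of the ensemble. -/
noncomputable def ensembleVector (β : ℂ) (Θ : ℝ) (k : Fin 5 × Fin 5) : Fin 2 → ℂ :=
  ![amplitude β Θ k.1, amplitude β Θ k.2]

lemma exists_twoParticleMatrix_eq (β : ℂ) {Θ : ℝ} (hΘ₀ : 0 ≤ Θ) (hΘ₁ : Θ < 1) :
    ∃ w : Fin 5 × Fin 5 → ℝ, (∀ k, 0 < w k) ∧
      twoParticleMatrix (displacedThermal β β Θ Θ) = productMixture w (ensembleVector β Θ) := by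
  obtain ⟨c, hc, hc'⟩ := modeMatrix_zero_zero β hΘ₀ hΘ₁
  have hZ := partitionFunction_pos hΘ₀ hΘ₁
  -- Each mode contributes its vacuum element `c` and a factor `1 / Z`; the 2 collects the `√2` of
  -- the row and of the column.
  refine ⟨fun k => c ^ 2 / (2 * partitionFunction Θ ^ 2) *
    (ensembleWeight k.1 * ensembleWeight k.2), fun k => ?_, ?_⟩
  · have h1 := ensembleWeight_pos k.1
    have h2 := ensembleWeight_pos k.2
    positivity
  ext x y
  have hle (z : Fin 2 × Fin 2) : (occupation z).1 ≤ 2 ∧ (occupation z).2 ≤ 2 := by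
    revert z
    decide
  have h1 := scaledModeMatrix_eq_moment β hΘ₀ hΘ₁ (hle x).1 (hle y).1
  have h2 := scaledModeMatrix_eq_moment β hΘ₀ hΘ₁ (hle x).2 (hle y).2
  have hsq : (Real.sqrt 2 : ℂ) * (Real.sqrt 2 : ℂ) = 2 := by
    simpa using ofReal_sqrt_mul_self (x := 2) (by norm_num)
  rw [hc'] at h1 h2
  have hprod : 2 * (symmetryFactor x * symmetryFactor y *
      (modeMatrix β Θ (occupation x).1 (occupation y).1 *
        modeMatrix β Θ (occupation x).2 (occupation y).2)) =
      scaledModeMatrix β Θ (occupation x).1 (occupation y).1 *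
        scaledModeMatrix β Θ (occupation x).2 (occupation y).2 := by
    simp only [scaledModeMatrix]
    rw [← hsq]
    linear_combination (modeMatrix β Θ (occupation x).1 (occupation y).1 *
      modeMatrix β Θ (occupation x).2 (occupation y).2) *
      ((Real.sqrt 2 : ℂ) * symmetryFactor y * sqrt_two_mul_symmetryFactor x +
        (Real.sqrt (occupation x).1.factorial : ℂ) *
          (Real.sqrt (occupation x).2.factorial : ℂ) * sqrt_two_mul_symmetryFactor y)
  have hrhs : productMixture (fun k : Fin 5 × Fin 5 => c ^ 2 / (2 * partitionFunction Θ ^ 2) *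
      (ensembleWeight k.1 * ensembleWeight k.2)) (ensembleVector β Θ) x y =
      c ^ 2 / (2 * (partitionFunction Θ : ℂ) ^ 2) *
        ((∑ i, (ensembleWeight i : ℂ) * (amplitude β Θ i ^ (occupation x).1 *
          starRingEnd ℂ (amplitude β Θ i) ^ (occupation y).1)) *
        (∑ i, (ensembleWeight i : ℂ) * (amplitude β Θ i ^ (occupation x).2 *
          starRingEnd ℂ (amplitude β Θ i) ^ (occupation y).2))) := by
    rw [Fintype.sum_mul_sum, ← Fintype.sum_prod_type', Finset.mul_sum, productMixture,
      Matrix.sum_apply]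
    refine Finset.sum_congr rfl fun k _ => ?_
    have e1 := pow_occupation x (amplitude β Θ k.1) (amplitude β Θ k.2)
    have e2 := congrArg (starRingEnd ℂ)
      (pow_occupation y (amplitude β Θ k.1) (amplitude β Θ k.2))
    simp only [map_mul, map_pow] at e2
    simp only [Matrix.smul_apply, Matrix.kroneckerMap_apply, dyad, Matrix.vecMulVec_apply,
      Pi.star_apply, smul_eq_mul, ensembleVector, RCLike.star_def]
    push_cast
    linear_combination (-(c ^ 2 / (2 * (partitionFunction Θ : ℂ) ^ 2) *
      (ensembleWeight k.1 * ensembleWeight k.2))) *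
      (starRingEnd ℂ (amplitude β Θ k.1) ^ (occupation y).1 *
        starRingEnd ℂ (amplitude β Θ k.2) ^ (occupation y).2 * e1 +
        ![amplitude β Θ k.1, amplitude β Θ k.2] x.1 *
        ![amplitude β Θ k.1, amplitude β Θ k.2] x.2 * e2)
  rw [h1, h2] at hprod
  rw [hrhs, twoParticleMatrix_apply, displacedThermal_apply β hΘ₀ hΘ₁]
  linear_combination (2 * (partitionFunction Θ : ℂ) ^ 2)⁻¹ * hprod

lemma sum_sqNorm_ensembleVector_pos {β : ℂ} {Θ : ℝ} (hΘ₀ : 0 ≤ Θ)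
    (hne : 0 < Θ ∨ β ≠ 0) {w : Fin 5 × Fin 5 → ℝ} (hw : ∀ k, 0 < w k) :
    0 < ∑ k, w k * sqNorm (ensembleVector β Θ k) ^ 2 := by
  -- The amplitudes at the ensemble points 0 and 1 are `(1 - Θ) β` and `(1 - Θ) β + √(2Θ)`; both
  -- vanish only for the excluded vacuum.
  obtain ⟨i, hi⟩ : ∃ i, amplitude β Θ i ≠ 0 := by
    by_contra! h
    have h0 := h 0
    have h1 := h 1
    simp only [amplitude, ensemblePoint, Matrix.cons_val, mul_zero, add_zero] at h0 h1
    rw [h0, zero_add, mul_one, Complex.ofReal_eq_zero, Real.sqrt_eq_zero (by positivity)] at h1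
    have hΘ : Θ = 0 := by linarith
    rcases hne with h | h
    · exact h.ne' hΘ
    · simp [hΘ] at h0
      exact h h0
  refine Finset.sum_pos' (fun k _ => mul_nonneg (hw k).le (sq_nonneg _))
    ⟨(i, i), Finset.mem_univ _, mul_pos (hw _) (pow_pos ?_ 2)⟩
  have := norm_pos_iff.2 hi
  simp only [sqNorm, ensembleVector, Matrix.cons_val]
  positivity

/-- The hypothesis says that a sesquilinear polynomial in `(α, α')` vanishes on the ensemble. Second
differences with step `√(2Θ)` remove the mean and isolate its coefficients. -/
lemma eq_zero_of_ensembleVector {β : ℂ} {Θ : ℝ} (hΘ : 0 < Θ) (x : Fin 2 × Fin 2 → ℂ)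
    (h : ∀ k, ∑ a, ∑ b, x (a, b) *
      (star (ensembleVector β Θ k a) * ensembleVector β Θ k b) = 0) : x = 0 := by
  have hs : (Real.sqrt (Θ * 2) : ℂ) ≠ 0 := ofReal_sqrt_ne_zero (by positivity)
  have h00 := h (0, 0)
  have h10 := h (1, 0)
  have h20 := h (2, 0)
  have h30 := h (3, 0)
  have h40 := h (4, 0)
  have h01 := h (0, 1)
  have h02 := h (0, 2)
  have h03 := h (0, 3)
  have h04 := h (0, 4)
  have h11 := h (1, 1)
  have h12 := h (1, 2)
  simp only [Fin.sum_univ_two, ensembleVector, amplitude, ensemblePoint, Matrix.cons_val,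
    RCLike.star_def, map_add, map_mul, map_sub, map_neg, map_one, map_zero, Complex.conj_ofReal,
    Complex.conj_I] at h00 h10 h20 h30 h40 h01 h02 h03 h04 h11 h12
  generalize (Real.sqrt (Θ * 2) : ℂ) = s at *
  have hs2 : s ^ 2 ≠ 0 := pow_ne_zero 2 hs
  have hI := Complex.I_sq
  -- The discrete Laplacian in the first amplitude leaves only the `|α|²` coefficient; likewise
  -- below for the second.
  have ha : x (0, 0) = 0 := by
    apply (mul_eq_zero.1 (_ : 4 * s ^ 2 * x (0, 0) = 0)).resolve_left
      (mul_ne_zero four_ne_zero hs2)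
    linear_combination h10 + h20 + h30 + h40 - 4 * h00 + 2 * s ^ 2 * x (0, 0) * hI
  have hd : x (1, 1) = 0 := by
    apply (mul_eq_zero.1 (_ : 4 * s ^ 2 * x (1, 1) = 0)).resolve_left
      (mul_ne_zero four_ne_zero hs2)
    linear_combination h01 + h02 + h03 + h04 - 4 * h00 + 2 * s ^ 2 * x (1, 1) * hI
  -- Mixed differences along `(1, 1)` and `(1, i)` give the sum and the difference of the
  -- off-diagonal coefficients.
  have hadd : x (0, 1) + x (1, 0) = 0 := by
    apply (mul_eq_zero.1 (_ : s ^ 2 * (x (0, 1) + x (1, 0)) = 0)).resolve_left hs2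
    linear_combination h11 - h10 - h01 + h00
  have hsub : x (0, 1) - x (1, 0) = 0 := by
    apply (mul_eq_zero.1 (_ : (s ^ 2 * Complex.I) * (x (0, 1) - x (1, 0)) = 0)).resolve_left
      (mul_ne_zero hs2 Complex.I_ne_zero)
    linear_combination h12 - h10 - h02 + h00
  have hb : x (0, 1) = 0 := by linear_combination (hadd + hsub) / 2
  have hc : x (1, 0) = 0 := by linear_combination (hadd - hsub) / 2
  ext ⟨a, b⟩
  fin_cases a <;> fin_cases b
  · exact ha
  · exact hb
  · exact hc
  · exact hd

end DisplacedThermal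

theorem mainTheorem3 (β : ℂ) (Θ : ℝ) (hΘ₀ : 0 ≤ Θ) (hΘ₁ : Θ < 1) (hne : 0 < Θ ∨ β ≠ 0) :
    -- the series defining the displaced Fock states and the displaced thermal state converge
    (∀ p n : ℕ, Summable (DisplacedThermal.displacementTerm β p n)) ∧
    (∀ n m : ℕ × ℕ, Summable (DisplacedThermal.thermalTerm β β Θ Θ n m)) ∧
    -- the two-photon component can be normalised to a state
    DisplacedThermal.IsDensityMatrix
      (DisplacedThermal.twoPhotonState (DisplacedThermal.displacedThermal β β Θ Θ)) ∧
    -- its partial transpose is positive, strictly so at positive temperature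
    (DisplacedThermal.partialTranspose
      (DisplacedThermal.twoPhotonState
        (DisplacedThermal.displacedThermal β β Θ Θ))).PosSemidef ∧
    (0 < Θ →
      (DisplacedThermal.partialTranspose
        (DisplacedThermal.twoPhotonState
          (DisplacedThermal.displacedThermal β β Θ Θ))).PosDef) ∧
    -- it is not formally entangled
    ¬ DisplacedThermal.IsFormallyEntangled
      (DisplacedThermal.twoPhotonState (DisplacedThermal.displacedThermal β β Θ Θ)) := by
  open DisplacedThermal in
  obtain ⟨w, hw, hM⟩ := exists_twoParticleMatrix_eq β hΘ₀ hΘ₁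
  have ht := sum_sqNorm_ensembleVector_pos hΘ₀ hne hw
  have hsep : IsSeparable (twoPhotonState (displacedThermal β β Θ Θ)) := by
    rw [twoPhotonState, hM]
    exact isSeparable_normalised_productMixture (fun k => (hw k).le) ht
  refine ⟨summable_displacementTerm β, summable_thermalTerm β hΘ₀ hΘ₁, hsep.isDensityMatrix,
    hsep.posSemidef_partialTranspose, fun hΘ => ?_, not_not_intro hsep⟩
  have hpd := posDef_partialTranspose_productMixture hw (eq_zero_of_ensembleVector (β := β) hΘ)
  rw [twoPhotonState, hM, trace_productMixture, ← Complex.ofReal_inv]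
  exact hpd.smul (Complex.zero_lt_real.2 (inv_pos.2 ht))
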